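/- Let $\mathbb{K}$ be a field of characteristic $0$. The hyperoctahedral group $B_n=\{\pm1\}^n\rtimes\mathcal{S}_n$ acts on $\mathbb{K}[\mathbf{x}_1,\ldots,\mathbf{x}_n]$ by $(\tau,\rho)\cdot \mathbf{x}_i=\tau_{\rho(i)}\mathbf{x}_{\rho(i)}$. For an ideal $J\subset\mathbb{K}[\mathbf{x}_1,\ldots,\mathbf{x}_n]$ put $V(J)=\{z\in\mathbb{K}^n: f(z)=0\text{ for all } f\in J\}$. A bipartition of $n$ is a pair $(\lambda,\mu)$ of partitions with $|\lambda|+|\mu|=n$ (with $\lambda_j=0$, $\mu_j=0$ beyond the length). A bipartition $(\lambda,\mu)$ of $n$ bidominates a bipartition $(\lambda',\mu')$ of $n$ if for all $k\ge 1$ $$\sum_{j=1}^{k}(\lambda'_j+\mu'_j)\le\sum_{j=1}^{k}(\lambda_j+\mu_j)\quad\text{and}\quad \sum_{j=1}^{k-1}(\lambda'_j+\mu'_j)+\lambda'_k\le\sum_{j=1}^{k-1}(\lambda_j+\mu_j)+\lambda_k .$$ A bitableau $(T,S)$ of shape $(\lambda,\mu)$ is a bijective filling of the boxes of the two Young diagrams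 of $\lambda$ and $\mu$ with $1,\ldots,n$. Its Specht polynomial is $\operatorname{sp}_{(T,S)}(\mathbf{x})=\prod_C\Delta_C(\mathbf{x}^2)\cdot\prod_{k\in S}\mathbf{x}_k$, where $C$ runs over the columns of $T$ and of $S$ and, for a column $C$ with entries $c_1,\ldots,c_r$ from top to bottom, $\Delta_C(\mathbf{x}^2)=\prod_{i<j}(\mathbf{x}_{c_i}^2-\mathbf{x}_{c_j}^2)$. The $B_n$-Specht ideal $I_{(\lambda,\mu)}$ is the ideal generated by all $\operatorname{sp}_{(T,S)}$ with $(T,S)$ of shape $(\lambda,\mu)$. For $z\in\mathbb{K}^n$ let $t$ be the number of zero coordinates of $z$, and let $\Lambda=(\Lambda_1\ge\Lambda_2\ge\cdots)$ be the partition of $n$ formed by the multiplicities of the distinct values among $z_1^2,\ldots,z_n^2$. The $B_n$-orbit type of $z$ is the bipartition $\Omega(z)=\big((\min(\Lambda_i,t))_i,(\max(\Lambda_i-t,0))_i\big)$ (zero parts deleted), and $H_{(\vartheta,\omega)}=\{z\in\mathbb{K}^n:\Omega(z)=(\vartheta,\omega)\}$. For a monomial $m$ in $\mathbf{x}_1,\ldots,\mathbf{x}_n$,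 write uniquely $m=\prod_{i\in I_1}\mathbf{x}_i^{2k_i}\prod_{i\in I_2}\mathbf{x}_i^{2r_i+1}$ with $I_1\cap I_2=\emptyset$, $k_i\ge1$ and $r_i\ge 0$; put $\ell=|I_1|$, $s=|I_2|$, $d_1=\sum_{i\in I_1}k_i$, $d_2=\sum_{i\in I_2}r_i$. If $\ell+s+d_1+d_2\le n$, let $\tilde\lambda$ be the partition with parts $k_i+1$ $(i\in I_1)$ together with $n-(\ell+s+d_1+d_2)$ parts equal to $1$, let $\tilde\mu$ be the partition with parts $r_i+1$ $(i\in I_2)$, and let $\Gamma^*(m)=(\tilde\lambda^{\perp},\tilde\mu^{\perp})$ be the pair of conjugate partitions; it is a bipartition of $n$. Statement. Let $I\subset\mathbb{K}[\mathbf{x}_1,\ldots,\mathbf{x}_n]$ be a $B_n$-invariant ideal, let $P\in I$, and let $m$ be a monomial occurring with nonzero coefficient in the homogeneous component $P_d$ of highest degree of $P$. Let $\operatorname{wt}(P_d)$ be the number of variables appearing in $P_d$, and assume that, with the notation above for $m$, $\operatorname{wt}(P_d)+d_1+d_2\le n$ (which implies $\ell+s+d_1+d_2\le n$). Then $$V(I)\subset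 V(I_{\Gamma^*(m)}),$$ and $V(I)\cap H_{(\vartheta,\omega)}=\emptyset$ for every bipartition $(\vartheta,\omega)$ of $n$ that is bidominated by $\Gamma^*(m)$. -/

import Mathlib

namespace BnSpecht

open MvPolynomial

/-! ### Partitions and bipartitions, through Young diagrams

A partition `λ` of `k` is a Young diagram `ν` with `ν.card = k`; with rows numbered from `0`,
`λ_{i+1} = ν.rowLen i`.  The conjugate partition is `ν.transpose`. -/

theorem card_ofRowLens (w : List ℕ) (hw : w.SortedGE) :
    (YoungDiagram.ofRowLens w hw).card = w.sum := by
  change (YoungDiagram.cellsOfRowLens w).card = w.sum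
  clear hw
  induction w with
  | nil => simp [YoungDiagram.cellsOfRowLens]
  | cons a w ih =>
    rw [YoungDiagram.cellsOfRowLens, Finset.card_union_of_disjoint, Finset.card_map, ih]
    · simp
    · rw [Finset.disjoint_left]
      rintro ⟨i, j⟩ h1 h2
      simp only [Finset.mem_product, Finset.mem_singleton, Finset.mem_map] at h1 h2
      obtain ⟨⟨a, b⟩, -, h⟩ := h2
      have := congrArg Prod.fst h
      simp at this
      omega

theorem card_transpose (ν : YoungDiagram) : ν.transpose.card = ν.card :=
  Finset.card_map _

theorem sum_rowLens (ν : YoungDiagram) : ν.rowLens.sum = ν.card := by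
  rw [← card_ofRowLens _ ν.rowLens_sorted, YoungDiagram.ofRowLens_to_rowLens_eq_self]

/-- The partition (Young diagram) whose row lengths are the nonzero members of `s`, rearranged in
non-increasing order. -/
def ofParts (s : Multiset ℕ) : YoungDiagram :=
  YoungDiagram.ofRowLens (s.sort (fun a b => b ≤ a)) (s.pairwise_sort (fun a b => b ≤ a)).sortedGE

theorem card_ofParts (s : Multiset ℕ) : (ofParts s).card = s.sum := by
  rw [ofParts, card_ofRowLens, ← Multiset.sum_coe, Multiset.sort_eq]

/-- A bipartition of `n`: a pair of partitions whose sizes add up to `n`. -/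
@[ext]
structure Bipartition (n : ℕ) where
  fst : YoungDiagram
  snd : YoungDiagram
  card_add : fst.card + snd.card = n

/-- The componentwise conjugate of a bipartition. -/
def Bipartition.conj {n : ℕ} (p : Bipartition n) : Bipartition n where
  fst := p.fst.transpose
  snd := p.snd.transpose
  card_add := by rw [card_transpose, card_transpose, p.card_add]

/-- `Bidominates p q`: the bipartition `p = (λ, μ)` bidominates `q = (λ', μ')`. -/
def Bidominates {n : ℕ} (p q : Bipartition n) : Prop :=
  ∀ k : ℕ,
    (∑ j ∈ Finset.range (k + 1), (q.fst.rowLen j + q.snd.rowLen j) ≤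
      ∑ j ∈ Finset.range (k + 1), (p.fst.rowLen j + p.snd.rowLen j)) ∧
    (∑ j ∈ Finset.range k, (q.fst.rowLen j + q.snd.rowLen j) + q.fst.rowLen k ≤
      ∑ j ∈ Finset.range k, (p.fst.rowLen j + p.snd.rowLen j) + p.fst.rowLen k)

/-! ### Specht polynomials, ideals and varieties -/

section Specht

variable (K : Type*) [Field K] {n : ℕ}

/-- The Specht polynomial of a filling `T` of the diagram `ν`: the product over all columns of the
Vandermonde polynomials of the entries of the column, read from top to bottom.  A cell is
`(row, column)`. -/
noncomputable def spechtPoly (ν : YoungDiagram) (T : ν.cells → Fin n) : MvPolynomial (Fin n) K :=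
  ∏ c : ν.cells × ν.cells with c.1.1.2 = c.2.1.2 ∧ c.1.1.1 < c.2.1.1,
    (X (T c.1) - X (T c.2))

/-- A bitableau of shape `p`: a filling of the boxes of both diagrams with the elements of
`Fin n`, each occurring exactly once. -/
abbrev Bitableau (p : Bipartition n) : Type := (p.fst.cells ⊕ p.snd.cells) ≃ Fin n

/-- The `B_n`-Specht polynomial `sp_T(x²) · sp_S(x²) · ∏_{k ∈ S} x_k` of a bitableau `(T, S)`;
`expand 2` substitutes `x_i²` for `x_i`. -/
noncomputable def bnSpechtPoly (p : Bipartition n) (T : Bitableau p) : MvPolynomial (Fin n) K :=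
  expand 2 (spechtPoly K p.fst (fun c => T (Sum.inl c))) *
    expand 2 (spechtPoly K p.snd (fun c => T (Sum.inr c))) *
    ∏ c : p.snd.cells, X (T (Sum.inr c))

/-- The `B_n`-Specht ideal of a bipartition. -/
noncomputable def spechtIdeal (p : Bipartition n) : Ideal (MvPolynomial (Fin n) K) :=
  Ideal.span (Set.range (bnSpechtPoly K p))

end Specht

/-! ### The hyperoctahedral group action -/

section Action

variable {K : Type*} [Field K] {n : ℕ}

/-- The action of the element `(τ, ρ)` of `B_n = {±1}^n ⋊ S_n`: the algebra map with
`x_i ↦ τ_{ρ(i)} x_{ρ(i)}`. -/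
noncomputable def bnAct (τ : Fin n → ℤˣ) (ρ : Equiv.Perm (Fin n)) :
    MvPolynomial (Fin n) K →ₐ[K] MvPolynomial (Fin n) K :=
  aeval (fun i => C (((τ (ρ i) : ℤˣ) : ℤ) : K) * X (ρ i))

/-- `B_n`-invariant ideals. -/
def IsBnInvariant (I : Ideal (MvPolynomial (Fin n) K)) : Prop :=
  ∀ f ∈ I, ∀ (τ : Fin n → ℤˣ) (ρ : Equiv.Perm (Fin n)), bnAct τ ρ f ∈ I

/-- The homogeneous component `P_d` of highest degree of `P`. -/
noncomputable def leadingForm (P : MvPolynomial (Fin n) K) : MvPolynomial (Fin n) K :=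
  homogeneousComponent P.totalDegree P

/-- The number of variables appearing in `P`. -/
noncomputable def wt (P : MvPolynomial (Fin n) K) : ℕ := P.vars.card

end Action

/-! ### Orbit types -/

section OrbitType

variable {K : Type*} {n : ℕ}

open Classical in
/-- The `S_n`-orbit type of `z`: the partition of `n` formed by the multiplicities of the distinct
values among the coordinates of `z`. -/
noncomputable def snOrbitType (z : Fin n → K) : YoungDiagram :=
  ofParts ((Finset.univ.image z).val.map (fun b => (Finset.univ.filter (fun i => z i = b)).card))

theorem card_snOrbitType (z : Fin n → K) : (snOrbitType z).card = n := by
  classical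
  rw [snOrbitType, card_ofParts]
  have h := Finset.card_eq_sum_card_image z (Finset.univ : Finset (Fin n))
  rw [Finset.card_univ, Fintype.card_fin] at h
  conv_rhs => rw [h]
  refine Finset.sum_congr (by congr!) (fun b _ => ?_)
  congr!

/-- The `t`-cut of a partition: `((min(λ_i, t))_i, (λ_i - t)_{i : λ_i > t})`. -/
def cut {n : ℕ} (ν : YoungDiagram) (hν : ν.card = n) (t : ℕ) : Bipartition n where
  fst := ofParts ((ν.rowLens : Multiset ℕ).map (fun a => min a t))
  snd := ofParts ((ν.rowLens : Multiset ℕ).map (fun a => a - t))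
  card_add := by
    rw [card_ofParts, card_ofParts, ← Multiset.sum_map_add]
    have : ∀ a : ℕ, min a t + (a - t) = a := fun a => by omega
    simp only [this, Multiset.map_id', Multiset.sum_coe, sum_rowLens, hν]

variable [Field K]

open Classical in
/-- The number of zero coordinates of `z`. -/
noncomputable def numZeros (z : Fin n → K) : ℕ := (Finset.univ.filter (fun i => z i = 0)).card

/-- The `B_n`-orbit type of a point of `K^n`. -/
noncomputable def bnOrbitType (z : Fin n → K) : Bipartition n :=
  cut (snOrbitType (fun i => z i ^ 2)) (card_snOrbitType _) (numZeros z)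

variable (K) in
/-- The `B_n`-orbit set of a bipartition. -/
def orbitSet (p : Bipartition n) : Set (Fin n → K) := {z | bnOrbitType z = p}

end OrbitType

/-! ### The bipartition attached to a monomial

A monomial `m` in `x_1, …, x_n` is given by its exponent vector `m : Fin n →₀ ℕ`. -/

section Gamma

variable {n : ℕ}

/-- The variables with nonzero even exponent `m i = 2 k_i`. -/
def evenSet (m : Fin n →₀ ℕ) : Finset (Fin n) :=
  Finset.univ.filter (fun i => Even (m i) ∧ m i ≠ 0)

/-- The variables with odd exponent `m i = 2 r_i + 1`. -/
def oddSet (m : Fin n →₀ ℕ) : Finset (Fin n) :=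
  Finset.univ.filter (fun i => Odd (m i))

/-- `d₁ = ∑ k_i`. -/
def d₁ (m : Fin n →₀ ℕ) : ℕ := ∑ i ∈ evenSet m, m i / 2

/-- `d₂ = ∑ r_i` (the division rounds down). -/
def d₂ (m : Fin n →₀ ℕ) : ℕ := ∑ i ∈ oddSet m, m i / 2

/-- The bipartition `Γ(m)`, defined when `ℓ + s + d₁ + d₂ ≤ n`. -/
def Gamma (m : Fin n →₀ ℕ) (h : (evenSet m).card + (oddSet m).card + d₁ m + d₂ m ≤ n) :
    Bipartition n where
  fst := ofParts ((evenSet m).val.map (fun i => m i / 2 + 1) +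
    Multiset.replicate (n - ((evenSet m).card + (oddSet m).card + d₁ m + d₂ m)) 1)
  snd := ofParts ((oddSet m).val.map (fun i => m i / 2 + 1))
  card_add := by
    have h1 : ((evenSet m).val.map (fun i => m i / 2 + 1)).sum = d₁ m + (evenSet m).card := by
      rw [Multiset.sum_map_add]; simp [d₁]
    have h2 : ((oddSet m).val.map (fun i => m i / 2 + 1)).sum = d₂ m + (oddSet m).card := by
      rw [Multiset.sum_map_add]; simp [d₂]
    rw [card_ofParts, card_ofParts, Multiset.sum_add, h1, h2, Multiset.sum_replicate, smul_eq_mul]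
    omega

/-- The bipartition `Γ*(m)`: the componentwise conjugate of `Γ(m)`. -/
def GammaStar (m : Fin n →₀ ℕ) (h : (evenSet m).card + (oddSet m).card + d₁ m + d₂ m ≤ n) :
    Bipartition n :=
  (Gamma m h).conj

/-- All variables of a monomial of `Q` appear in `Q`, so that `ℓ + s ≤ wt(Q)`. -/
theorem gamma_cond {K : Type*} [Field K] {Q : MvPolynomial (Fin n) K} {m : Fin n →₀ ℕ}
    (hm : m ∈ Q.support) (h : wt Q + d₁ m + d₂ m ≤ n) :
    (evenSet m).card + (oddSet m).card + d₁ m + d₂ m ≤ n := by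
  have hd : Disjoint (evenSet m) (oddSet m) := by
    rw [Finset.disjoint_left]
    intro i hi hi'
    simp only [evenSet, oddSet, Finset.mem_filter] at hi hi'
    exact (Nat.not_even_iff_odd.2 hi'.2) hi.2.1
  have hs : evenSet m ∪ oddSet m ⊆ Q.vars := by
    intro i hi
    rw [MvPolynomial.mem_vars_iff_mem_support]
    refine ⟨m, hm, ?_⟩
    simp only [evenSet, oddSet, Finset.mem_union, Finset.mem_filter] at hi
    rw [Finsupp.mem_support_iff]
    rcases hi with hi | hi
    · exact hi.2.2
    · exact fun h0 => by simp [h0] at hi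
  have := Finset.card_le_card hs
  rw [Finset.card_union_of_disjoint hd] at this
  unfold wt at h
  omega

end Gamma

end BnSpecht

namespace BnSpecht

open MvPolynomial

/-! ### Column determinants -/

section ColumnDet

variable {α : Type*} [Fintype α]

/-! The ideal `I` contains the whole Specht ideal of `GammaStar m`. The first conclusion follows by
reversing the inclusion. For the second, at a point whose orbit type is bidominated by `GammaStar m`
some Specht polynomial of that shape does not vanish.

Containment (`spechtIdeal_GammaStar_le`): each variable of the leading form is put at the bottom of
its own column, of height `m i / 2 + 1`, in the first or second diagram according to the parity of
`m i`. The weight hypothesis leaves enough columns of height one for the variables missing from `m`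
(`map_even_le`). The other boxes are filled arbitrarily, and `P` is multiplied by a monomial in the
remaining variables so that `m` acquires the exponent `2r` or `2r + 1` in row `r`. Averaging over
sign changes and antisymmetrizing along columns turns this monomial into a nonzero multiple of a
product of Vandermonde determinants, which is a Specht polynomial up to sign. All other monomials of
`P` die: a survivor has the right parities and distinct exponents within each column, so its degree
is at least that of `m`, and equality forces it to be `m` (`det_colMatrix_mem`).

Nonvanishing (`exists_aeval_bnSpechtPoly_ne_zero`): it suffices that the squares of the coordinates
are distinct within each column and that no zero lies in the second diagram. Distributing the values
over the columns is a 0-1 matrix problem with prescribed margins in which the value 0 is confined to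
the first diagram. Bidominance supplies the Gale–Ryser inequalities for it
(`bidominates_bnOrbitType`, `exists_incidence_restricted`). -/

/-- `row` numbers the members of each class of `col` consecutively from zero. -/
structure IsRowIndex (col row : α → ℕ) : Prop where
  inj : ∀ a b, col a = col b → row a = row b → a = b
  lower : ∀ a r, r < row a → ∃ b, col b = col a ∧ row b = r

/-- The rows occurring in one class form a finite lower set of `ℕ`, hence an initial segment. -/
theorem IsRowIndex.exists_equiv {col row : α → ℕ} (h : IsRowIndex col row) (k : ℕ) :
    ∃ (c : ℕ) (e : {a // col a = k} ≃ Fin c), ∀ a, (e a : ℕ) = row a := by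
  set s : Finset ℕ := (Finset.univ.filter fun a => col a = k).image row with hs
  have hmem : ∀ r, r ∈ s ↔ ∃ a, col a = k ∧ row a = r := by simp [hs]
  have hlow : ∃ c, s = Finset.range c := by
    have : IsLowerSet (s : Set ℕ) := by
      intro r q hq hr
      rcases hq.eq_or_lt with rfl | hq
      · exact hr
      · obtain ⟨a, ha, rfl⟩ := (hmem r).1 hr
        obtain ⟨b, hb, hb'⟩ := h.lower a q hq
        exact (hmem q).2 ⟨b, hb.trans ha, hb'⟩
    refine ⟨s.card, ?_⟩
    have hsub : s ⊆ Finset.range s.card := by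
      intro r hr
      have : Finset.range (r + 1) ⊆ s := fun q hq =>
        this (Nat.lt_succ_iff.1 (Finset.mem_range.1 hq)) hr
      have := Finset.card_le_card this
      simp at this
      exact Finset.mem_range.2 this
    exact Finset.eq_of_subset_of_card_le hsub (by simp)
  obtain ⟨c, hc⟩ := hlow
  have hlt : ∀ a : {a // col a = k}, row a < c := fun a =>
    Finset.mem_range.1 (hc ▸ (hmem _).2 ⟨a, a.2, rfl⟩)
  refine ⟨c, Equiv.ofBijective (fun a => ⟨row a, hlt a⟩) ⟨?_, ?_⟩, fun a => rfl⟩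
  · intro a b hab
    exact Subtype.ext (h.inj a b (a.2.trans b.2.symm) (by simpa using hab))
  · intro r
    obtain ⟨a, ha, har⟩ := (hmem r).1 (hc ▸ Finset.mem_range.2 r.2)
    exact ⟨⟨a, ha⟩, Fin.ext har⟩

variable [DecidableEq α] {R : Type*} [CommRing R]

theorem det_pow_equiv_fin {c : ℕ} (e : α ≃ Fin c) (y : α → R) :
    (Matrix.of fun a b => y a ^ (e b : ℕ)).det =
      ∏ a, ∏ b, if e a < e b then y b - y a else 1 := by
  have h : (Matrix.of fun a b => y a ^ (e b : ℕ)) =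
      (Matrix.vandermonde (y ∘ e.symm)).submatrix e e := by
    ext a b; simp [Matrix.vandermonde_apply]
  rw [h, Matrix.det_submatrix_equiv_self, Matrix.det_vandermonde]
  refine (Fintype.prod_equiv e _ _ fun a => ?_).symm
  rw [← Finset.filter_lt_eq_Ioi, Finset.prod_filter]
  exact Fintype.prod_equiv e _ _ fun b => by simp

/-- The matrix whose `b`-th column is supported on the indices in the same class of `col` as `b`,
with entries `x a ^ e b`. -/
def colMatrix (col : α → ℕ) (x : α → R) (e : α → ℕ) : Matrix α α R :=
  Matrix.of fun a b => if col a = col b then x a ^ e b else 0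

theorem det_colMatrix_eq_zero {col : α → ℕ} {x : α → R} {e : α → ℕ} {a b : α} (hab : a ≠ b)
    (hc : col a = col b) (he : e a = e b) : (colMatrix col x e).det = 0 :=
  Matrix.det_zero_of_column_eq hab fun k => by simp [colMatrix, hc, he]

/-- The matrix is block diagonal along the classes of `col`. Once `x a ^ (k % 2)` is pulled out of
each row, the block of class `k` is a Vandermonde matrix in the squares. -/
theorem det_colMatrix {col row : α → ℕ} (h : IsRowIndex col row) (x : α → R) :
    (colMatrix col x fun a => 2 * row a + col a % 2).det =
      (∏ a, x a ^ (col a % 2)) *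
        ∏ a, ∏ b, if col a = col b ∧ row a < row b then x b ^ 2 - x a ^ 2 else 1 := by
  have hbt : Matrix.BlockTriangular (colMatrix col x fun a => 2 * row a + col a % 2) col := by
    intro a b hab
    simp [colMatrix, hab.ne']
  rw [hbt.det, ← Finset.prod_mul_distrib,
    ← Finset.prod_fiberwise_of_maps_to (s := Finset.univ) (t := Finset.univ.image col) (g := col)
      (fun a _ => Finset.mem_image_of_mem _ (Finset.mem_univ a))]
  refine Finset.prod_congr rfl fun k _ => ?_
  obtain ⟨c, e, he⟩ := h.exists_equiv k
  have hblock : (colMatrix col x fun a => 2 * row a + col a % 2).toSquareBlock col k =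
      Matrix.of fun (a b : {a // col a = k}) => x a ^ (k % 2) *
        (Matrix.of fun (a b : {a // col a = k}) => (x a ^ 2) ^ (e b : ℕ)) a b := by
    ext a b
    simp only [colMatrix, Matrix.toSquareBlock_def, Matrix.of_apply, a.2, b.2, he, if_true]
    rw [← pow_mul, ← pow_add, add_comm]
  rw [hblock, Matrix.det_mul_column, det_pow_equiv_fin, ← Finset.prod_mul_distrib,
    Finset.prod_subtype (Finset.univ.filter fun a => col a = k) (p := fun a => col a = k) (by simp)]
  refine Finset.prod_congr rfl fun a _ => ?_
  rw [a.2]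
  congr 1
  simp only [Fin.lt_def, he]
  rw [← Finset.prod_subtype (Finset.univ.filter fun a => col a = k) (p := fun a => col a = k)
    (by simp) (fun b => if row a < row b then x b ^ 2 - x a ^ 2 else 1), Finset.prod_filter]
  refine Finset.prod_congr rfl fun b _ => ?_
  by_cases hb : col b = k
  · simp [hb]
  · simp [hb, Ne.symm hb]

end ColumnDet

/-! ### Signed averages over the hyperoctahedral group -/

section Average

variable {K : Type*} [Field K] {n : ℕ}

theorem bnAct_monomial (τ : Fin n → ℤˣ) (ρ : Equiv.Perm (Fin n)) (e : Fin n →₀ ℕ) (c : K) :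
    bnAct τ ρ (monomial e c) =
      C (c * ∏ i, (((τ (ρ i) : ℤˣ) : ℤ) : K) ^ e i) * ∏ i, X (ρ i) ^ e i := by
  rw [bnAct, aeval_monomial, Finsupp.prod_fintype _ _ (by simp)]
  simp only [mul_pow, Finset.prod_mul_distrib, C_mul, map_prod, map_pow, algebraMap_eq, mul_assoc]

theorem sum_units_pow (k : ℕ) :
    ∑ u : ℤˣ, (((u : ℤˣ) : ℤ) : K) ^ k = if Even k then 2 else 0 := by
  rw [UnitsInt.univ, Finset.sum_pair (by decide)]
  rcases Nat.even_or_odd k with h | h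
  · simp [h, h.neg_pow]; norm_num
  · simp [Nat.not_even_iff_odd.2 h, h.neg_pow]

theorem sum_signs_pow (k : Fin n → ℕ) :
    ∑ τ : Fin n → ℤˣ, ∏ i, (((τ i : ℤˣ) : ℤ) : K) ^ k i =
      if ∀ i, Even (k i) then 2 ^ n else 0 := by
  rw [← Fintype.prod_sum fun i (u : ℤˣ) => ((u : ℤ) : K) ^ k i]
  simp only [sum_units_pow]
  split_ifs with h
  · simp [h]
  · push Not at h
    obtain ⟨i, hi⟩ := h
    exact Finset.prod_eq_zero (Finset.mem_univ i) (by simp [hi])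

/-- The projection (up to the factor `2 ^ n`) onto the monomials whose exponents have the parities
prescribed by `s`. -/
noncomputable def signAverage (s : Fin n → ℕ) (Q : MvPolynomial (Fin n) K) :
    MvPolynomial (Fin n) K :=
  ∑ τ : Fin n → ℤˣ, C (∏ i, (((τ i : ℤˣ) : ℤ) : K) ^ s i) * bnAct τ 1 Q

theorem signAverage_mem {I : Ideal (MvPolynomial (Fin n) K)} (hI : IsBnInvariant I)
    (s : Fin n → ℕ) {Q : MvPolynomial (Fin n) K} (hQ : Q ∈ I) : signAverage s Q ∈ I :=
  Ideal.sum_mem _ fun τ _ => I.mul_mem_left _ (hI Q hQ τ 1)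

/-- Orthogonality of characters: sign changes multiply a monomial by a character that depends only
on the parities of its exponents. -/
theorem signAverage_monomial (s : Fin n → ℕ) (e : Fin n →₀ ℕ) (c : K) :
    signAverage s (monomial e c) =
      if ∀ i, Even (s i + e i) then C (2 ^ n) * monomial e c else 0 := by
  have h : ∀ τ : Fin n → ℤˣ, C (∏ i, (((τ i : ℤˣ) : ℤ) : K) ^ s i) * bnAct τ 1 (monomial e c) =
      C (∏ i, (((τ i : ℤˣ) : ℤ) : K) ^ (s i + e i)) * monomial e c := by
    intro τ
    rw [bnAct_monomial, monomial_eq, Finsupp.prod_fintype _ _ (by simp)]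
    simp only [pow_add, Finset.prod_mul_distrib, C_mul, Equiv.Perm.coe_one, id]
    ring
  simp only [signAverage, h]
  rw [← Finset.sum_mul, ← map_sum, sum_signs_pow]
  split_ifs <;> simp

/-- The antisymmetrization over the permutations preserving the classes of `col`. -/
noncomputable def colAntisymm (col : Fin n → ℕ) (Q : MvPolynomial (Fin n) K) :
    MvPolynomial (Fin n) K :=
  ∑ σ : Equiv.Perm (Fin n) with ∀ b, col (σ b) = col b,
    ((Equiv.Perm.sign σ : ℤ) : MvPolynomial (Fin n) K) * bnAct 1 σ Q

theorem colAntisymm_mem {I : Ideal (MvPolynomial (Fin n) K)} (hI : IsBnInvariant I)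
    (col : Fin n → ℕ) {Q : MvPolynomial (Fin n) K} (hQ : Q ∈ I) : colAntisymm col Q ∈ I :=
  Ideal.sum_mem _ fun σ _ => I.mul_mem_left _ (hI Q hQ 1 σ)

/-- This is the Leibniz expansion: a permutation that moves an index out of its class picks up a
zero entry of the matrix. -/
theorem colAntisymm_monomial (col : Fin n → ℕ) (e : Fin n →₀ ℕ) (c : K) :
    colAntisymm col (monomial e c) = C c * (colMatrix col X e).det := by
  rw [Matrix.det_apply', Finset.mul_sum, colAntisymm, Finset.sum_filter]
  refine Finset.sum_congr rfl fun σ _ => ?_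
  split_ifs with h
  · rw [bnAct_monomial]
    simp only [colMatrix, Matrix.of_apply, h, if_true]
    simp
    ring
  · push Not at h
    obtain ⟨b, hb⟩ := h
    rw [Finset.prod_eq_zero (Finset.mem_univ b) (by simp [colMatrix, hb])]
    simp

/-- The composite of `signAverage` and `colAntisymm`. -/
noncomputable def bnAverage (col : Fin n → ℕ) (Q : MvPolynomial (Fin n) K) :
    MvPolynomial (Fin n) K :=
  colAntisymm col (signAverage (fun i => col i % 2) Q)

theorem bnAverage_mem {I : Ideal (MvPolynomial (Fin n) K)} (hI : IsBnInvariant I)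
    (col : Fin n → ℕ) {Q : MvPolynomial (Fin n) K} (hQ : Q ∈ I) : bnAverage col Q ∈ I :=
  colAntisymm_mem hI _ (signAverage_mem hI _ hQ)

theorem bnAverage_sum {β : Type*} (col : Fin n → ℕ) (s : Finset β)
    (f : β → MvPolynomial (Fin n) K) :
    bnAverage col (∑ b ∈ s, f b) = ∑ b ∈ s, bnAverage col (f b) := by
  simp only [bnAverage, colAntisymm, signAverage, map_sum, Finset.mul_sum]
  conv_rhs => rw [Finset.sum_comm]
  refine Finset.sum_congr rfl fun σ _ => ?_
  conv_rhs => rw [Finset.sum_comm]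

end Average

/-! ### Specht polynomials in invariant ideals -/

section Minimal

theorem sum_range_card_le_sum (s : Finset ℕ) : ∑ i ∈ Finset.range s.card, i ≤ ∑ i ∈ s, i := by
  induction s using Finset.induction_on_max with
  | empty => simp
  | insert a s ha ih =>
    have hmem : a ∉ s := fun h => (ha a h).false
    have hcard : s.card ≤ a := by
      simpa using Finset.card_le_card (fun x hx => Finset.mem_range.2 (ha x hx) :
        s ⊆ Finset.range a)
    rw [Finset.card_insert_of_notMem hmem, Finset.sum_range_succ, Finset.sum_insert hmem]
    omega

/-- In a class of size `c` the rows are `0, …, c - 1`, the cheapest choice of `c` distinct naturals.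
This bounds from below the degree of any monomial that survives antisymmetrization. -/
theorem IsRowIndex.sum_row_le {α : Type*} [Fintype α] {col row : α → ℕ} (h : IsRowIndex col row)
    {f : α → ℕ} (hf : ∀ a b, col a = col b → f a = f b → a = b) : ∑ a, row a ≤ ∑ a, f a := by
  classical
  rw [← Finset.sum_fiberwise_of_maps_to (s := Finset.univ) (t := Finset.univ.image col) (g := col)
      (fun a _ => Finset.mem_image_of_mem _ (Finset.mem_univ a)),
    ← Finset.sum_fiberwise_of_maps_to (s := Finset.univ) (t := Finset.univ.image col) (g := col)
      (fun a _ => Finset.mem_image_of_mem _ (Finset.mem_univ a)) f]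
  refine Finset.sum_le_sum fun k _ => ?_
  obtain ⟨c, e, he⟩ := h.exists_equiv k
  have hcard : (Finset.univ.filter fun a => col a = k).card = c := by
    rw [← Fintype.card_subtype, Fintype.card_congr e, Fintype.card_fin]
  have hfi : Set.InjOn f (Finset.univ.filter fun a => col a = k) := by
    intro a ha b hb hab
    replace ha := (Finset.mem_filter.1 (Finset.mem_coe.1 ha)).2
    replace hb := (Finset.mem_filter.1 (Finset.mem_coe.1 hb)).2
    exact hf a b (ha.trans hb.symm) hab
  calc ∑ a with col a = k, row a = ∑ a : {a // col a = k}, row a :=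
        Finset.sum_subtype _ (by simp) _
    _ = ∑ i : Fin c, (i : ℕ) := Fintype.sum_equiv e _ _ fun a => (he a).symm
    _ = ∑ i ∈ Finset.range c, i := Fin.sum_univ_eq_sum_range (fun i => i) c
    _ ≤ ∑ i ∈ (Finset.univ.filter fun a => col a = k).image f, i := by
        rw [← hcard, ← Finset.card_image_of_injOn hfi]
        exact sum_range_card_le_sum _
    _ = _ := Finset.sum_image hfi

end Minimal

/-! ### Isolating one monomial by averaging -/

section Membership

variable {K : Type*} [Field K] {n : ℕ}

theorem bnAverage_monomial (col : Fin n → ℕ) (e : Fin n →₀ ℕ) (c : K) :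
    bnAverage col (monomial e c) =
      if ∀ i, Even (col i % 2 + e i) then C (2 ^ n * c) * (colMatrix col X e).det else 0 := by
  rw [bnAverage, signAverage_monomial]
  split_ifs
  · rw [C_mul_monomial, colAntisymm_monomial]
  · simp [colAntisymm]

theorem mem_support_leadingForm {P : MvPolynomial (Fin n) K} {m : Fin n →₀ ℕ} :
    m ∈ (leadingForm P).support ↔ m ∈ P.support ∧ m.degree = P.totalDegree := by
  classical
  rw [leadingForm, mem_support_iff, coeff_homogeneousComponent, mem_support_iff]
  split_ifs with h <;> simp [h]

/-- If the variables of the leading form of `P ∈ I` sit at the bottoms of different columns, and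
the exponents of a monomial `m` of the leading form match the positions, then `I` contains the
determinant attached to the columns. -/
theorem det_colMatrix_mem [CharZero K] {I : Ideal (MvPolynomial (Fin n) K)}
    (hI : IsBnInvariant I) {P : MvPolynomial (Fin n) K} (hP : P ∈ I) {m : Fin n →₀ ℕ}
    (hm : m ∈ (leadingForm P).support) {col row : Fin n → ℕ} (h : IsRowIndex col row)
    (htop : ∀ i ∈ (leadingForm P).vars, ∀ b, col b = col i → row b ≤ row i)
    (hexp : ∀ i ∈ (leadingForm P).vars, m i = 2 * row i + col i % 2) :
    (colMatrix col (X : Fin n → MvPolynomial (Fin n) K) fun a => 2 * row a + col a % 2).det ∈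
      I := by
  classical
  set std : Fin n → ℕ := fun a => 2 * row a + col a % 2 with hstd
  set V := (leadingForm P).vars with hV
  have hsupp : ∀ u ∈ (leadingForm P).support, ∀ i, i ∉ V → u i = 0 := by
    intro u hu i hi
    by_contra h0
    exact hi ((mem_vars_iff_mem_support i).2 ⟨u, hu, Finsupp.mem_support_iff.2 h0⟩)
  -- The multiplier uses only variables outside the leading form and completes `m` to the exponents
  -- `std`.
  let M : Fin n →₀ ℕ := Finsupp.equivFunOnFinite.symm fun a => if a ∈ V then 0 else std a
  have hM : ∀ a, M a = if a ∈ V then 0 else std a := fun a => rfl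
  have hmM : ∀ a, m a + M a = std a := by
    intro a
    rw [hM]
    split_ifs with ha
    · exact hexp a ha
    · rw [hsupp m hm a ha, zero_add]
  have hmP := mem_support_leadingForm.1 hm
  have key : ∀ u ∈ P.support, u ≠ m → bnAverage col (monomial (u + M) (coeff u P)) = 0 := by
    intro u hu hne
    rw [bnAverage_monomial]
    split_ifs with hpar
    swap
    · rfl
    by_cases hinj : ∀ a b, col a = col b → (u + M) a = (u + M) b → a = b
    swap
    · push Not at hinj
      obtain ⟨a, b, hc, he, hab⟩ := hinj
      rw [det_colMatrix_eq_zero hab hc he, mul_zero]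
    exfalso
    have hpar' : ∀ a, (u + M) a % 2 = col a % 2 := by
      intro a
      have := hpar a
      rw [Nat.even_iff] at this
      omega
    -- Parities are constant along a column, so halving keeps the exponents there distinct and the
    -- minimality of `row` applies.
    have hle : ∑ a, std a ≤ ∑ a, (u + M) a := by
      have h1 := h.sum_row_le (f := fun a => (u + M) a / 2) (by
        intro a b hc hab
        refine hinj a b hc ?_
        have := hpar' a
        have := hpar' b
        rw [hc] at *
        omega)
      have h2 : ∀ a, (u + M) a = 2 * ((u + M) a / 2) + col a % 2 := by
        intro a
        have := hpar' a
        omega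
      rw [Finset.sum_congr rfl fun a _ => h2 a, Finset.sum_add_distrib, Finset.sum_add_distrib,
        ← Finset.mul_sum, ← Finset.mul_sum]
      omega
    have hdeg : m.degree ≤ u.degree := by
      have : ∑ a, std a = m.degree + ∑ a, M a := by
        rw [Finsupp.degree_eq_sum, ← Finset.sum_add_distrib]
        exact Finset.sum_congr rfl fun a _ => (hmM a).symm
      have h' : ∑ a, (u + M) a = u.degree + ∑ a, M a := by
        rw [Finsupp.degree_eq_sum, ← Finset.sum_add_distrib]
        rfl
      omega
    have hdeg' : u.degree = P.totalDegree :=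
      le_antisymm (le_totalDegree hu) (hmP.2 ▸ hdeg)
    have huL : u ∈ (leadingForm P).support := mem_support_leadingForm.2 ⟨hu, hdeg'⟩
    have hnv : ∀ a, a ∉ V → (u + M) a = std a := by
      intro a ha
      rw [Finsupp.add_apply, hsupp u huL a ha, hM, if_neg ha, zero_add]
    have hge : ∀ a, m a ≤ u a := by
      intro a
      by_cases ha : a ∈ V
      swap
      · rw [hsupp m hm a ha]; exact Nat.zero_le _
      have h1 : (u + M) a = u a := by rw [Finsupp.add_apply, hM, if_pos ha, add_zero]
      rw [hexp a ha]
      by_contra hlt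
      have h2 := hpar' a
      rw [h1] at h2
      -- If `u a` were smaller than `m a`, some `b` higher up in the same column would already carry
      -- the exponent `u a`: it is not a bottom box, so it lies outside `V` and its exponent is `std
      -- b`. Two equal exponents in a column are excluded.
      obtain ⟨b, hb, hbr⟩ := h.lower a (u a / 2) (by omega)
      have hbV : b ∉ V := by
        intro hbV
        have := htop b hbV a hb.symm
        omega
      have := hinj a b hb.symm (by
        rw [h1, hnv b hbV, hstd]
        simp only [hb, hbr]
        omega)
      subst this
      exact hbV ha
    refine hne (Finsupp.ext fun a => ?_)
    have hs : ∑ a, m a = ∑ a, u a := by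
      rw [← Finsupp.degree_eq_sum, ← Finsupp.degree_eq_sum, hmP.2, hdeg']
    exact ((Finset.sum_eq_sum_iff_of_le fun a _ => hge a).1 hs a (Finset.mem_univ a)).symm
  have hmem : bnAverage col (P * monomial M 1) ∈ I :=
    bnAverage_mem hI col (I.mul_mem_right _ hP)
  have hPM : P * monomial M 1 = ∑ u ∈ P.support, monomial (u + M) (coeff u P) := by
    conv_lhs => rw [P.as_sum, Finset.sum_mul]
    exact Finset.sum_congr rfl fun u _ => by rw [monomial_mul, mul_one]
  rw [hPM, bnAverage_sum, Finset.sum_eq_single_of_mem m hmP.1 fun u hu hne => key u hu hne,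
    bnAverage_monomial, if_pos (by
      intro i
      rw [Finsupp.add_apply, hmM, hstd, Nat.even_iff]
      dsimp only
      omega)] at hmem
  have hfun : ((m + M : Fin n →₀ ℕ) : Fin n → ℕ) = std := funext hmM
  rw [hfun] at hmem
  -- The characteristic matters here: the factor `2 ^ n` from the sign average must be invertible.
  have hunit : (2 ^ n * coeff m P : K) ≠ 0 :=
    mul_ne_zero (pow_ne_zero _ two_ne_zero) (mem_support_iff.1 hmP.1)
  have := I.mul_mem_left (C (2 ^ n * coeff m P : K)⁻¹) hmem
  rwa [← mul_assoc, ← C_mul, inv_mul_cancel₀ hunit, C_1, one_mul] at this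

end Membership

/-! ### Columns of a bipartition -/

section Cells

variable {n : ℕ}

/-- The number of the column of a cell: the columns of the first diagram have even numbers, those
of the second diagram odd numbers. -/
def cellCol (p : Bipartition n) : p.fst.cells ⊕ p.snd.cells → ℕ :=
  Sum.elim (fun c => 2 * c.1.2) (fun c => 2 * c.1.2 + 1)

/-- The row of a cell. -/
def cellRow (p : Bipartition n) : p.fst.cells ⊕ p.snd.cells → ℕ :=
  Sum.elim (fun c => c.1.1) (fun c => c.1.1)

theorem isRowIndex_cells (p : Bipartition n) : IsRowIndex (cellCol p) (cellRow p) where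
  inj := by
    rintro (⟨⟨i, j⟩, h⟩ | ⟨⟨i, j⟩, h⟩) (⟨⟨i', j'⟩, h'⟩ | ⟨⟨i', j'⟩, h'⟩) hc hr <;>
      simp [cellCol, cellRow] at hc hr ⊢ <;> omega
  lower := by
    rintro (⟨⟨i, j⟩, h⟩ | ⟨⟨i, j⟩, h⟩) r hr
    · exact ⟨Sum.inl ⟨(r, j), p.fst.up_left_mem hr.le le_rfl h⟩, rfl, rfl⟩
    · exact ⟨Sum.inr ⟨(r, j), p.snd.up_left_mem hr.le le_rfl h⟩, rfl, rfl⟩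

theorem IsRowIndex.comp_equiv {α β : Type*} {col row : α → ℕ} (h : IsRowIndex col row)
    (e : β ≃ α) : IsRowIndex (col ∘ e) (row ∘ e) where
  inj a b hc hr := e.injective (h.inj _ _ hc hr)
  lower a r hr := by
    obtain ⟨b, hb, hb'⟩ := h.lower (e a) r hr
    exact ⟨e.symm b, by simpa using hb, by simpa using hb'⟩

variable (K : Type*) [Field K]

theorem expand_spechtPoly (ν : YoungDiagram) (T : ν.cells → Fin n) :
    expand 2 (spechtPoly K ν T) = ∏ a : ν.cells, ∏ b : ν.cells,
      if a.1.2 = b.1.2 ∧ a.1.1 < b.1.1 then X (T a) ^ 2 - X (T b) ^ 2 else 1 := by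
  rw [spechtPoly, map_prod, Finset.prod_filter, Fintype.prod_prod_type]
  simp

/-- Since the parity of the column number records the diagram, both diagrams are handled by one
product, and the linear factors of the second diagram become the exponents `cellCol p a % 2`. -/
theorem bnSpechtPoly_eq (p : Bipartition n) (T : Bitableau p) :
    bnSpechtPoly K p T = (∏ a, X (T a) ^ (cellCol p a % 2)) *
      ∏ a, ∏ b, if cellCol p a = cellCol p b ∧ cellRow p a < cellRow p b then
        X (T a) ^ 2 - X (T b) ^ 2 else 1 := by
  have h1 : ∀ a b : ℕ, 2 * a ≠ 2 * b + 1 := fun a b => by omega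
  have h2 : ∀ a b : ℕ, 2 * b + 1 ≠ 2 * a := fun a b => by omega
  have h3 : ∀ a : ℕ, (2 * a + 1) % 2 = 1 := fun a => by omega
  rw [bnSpechtPoly, expand_spechtPoly, expand_spechtPoly]
  simp only [Fintype.prod_sum_type, cellCol, cellRow, Sum.elim_inl, Sum.elim_inr, h1, h2, h3,
    false_and, if_false, Finset.prod_const_one, mul_one, one_mul, Nat.mul_mod_right, pow_zero,
    pow_one, add_left_inj, mul_right_inj' (two_ne_zero (α := ℕ))]
  ring

/-- The two sides differ only in the orientation of each difference of squares; `ε` collects the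
resulting signs. -/
theorem bnSpechtPoly_eq_det (p : Bipartition n) (T : Bitableau p) :
    ∃ ε : MvPolynomial (Fin n) K, bnSpechtPoly K p T =
      ε * (colMatrix (cellCol p ∘ T.symm) X
        fun a => 2 * (cellRow p ∘ T.symm) a + (cellCol p ∘ T.symm) a % 2).det := by
  rw [det_colMatrix ((isRowIndex_cells p).comp_equiv T.symm), bnSpechtPoly_eq]
  refine ⟨∏ a, ∏ b, if cellCol p a = cellCol p b ∧ cellRow p a < cellRow p b then -1 else 1, ?_⟩
  rw [mul_left_comm]
  congr 1
  · exact Fintype.prod_equiv T _ _ fun a => by simp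
  · rw [← Fintype.prod_equiv T _ _ (fun a => rfl), ← Finset.prod_mul_distrib]
    refine Finset.prod_congr rfl fun a _ => ?_
    rw [← Fintype.prod_equiv T _ _ (fun a => rfl), ← Finset.prod_mul_distrib]
    refine Finset.prod_congr rfl fun b _ => ?_
    simp only [Function.comp, Equiv.symm_apply_apply]
    split_ifs <;> ring

variable {K}

theorem bnAct_bnSpechtPoly (p : Bipartition n) (T : Bitableau p) (ρ : Equiv.Perm (Fin n)) :
    bnAct 1 ρ (bnSpechtPoly K p T) = bnSpechtPoly K p (T.trans ρ) := by
  rw [bnSpechtPoly_eq, bnSpechtPoly_eq, map_mul, map_prod, map_prod]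
  have hX : ∀ i, bnAct (K := K) 1 ρ (X i) = X (ρ i) := fun i => by simp [bnAct]
  congr 1
  · simp [hX]
  · refine Finset.prod_congr rfl fun a _ => ?_
    rw [map_prod]
    refine Finset.prod_congr rfl fun b _ => ?_
    split_ifs <;> simp [hX]

/-- A single bitableau whose columns fit the leading form of `P ∈ I` forces the whole Specht ideal
into `I`. -/
theorem spechtIdeal_le_of_fit [CharZero K] {I : Ideal (MvPolynomial (Fin n) K)}
    (hI : IsBnInvariant I) {P : MvPolynomial (Fin n) K} (hP : P ∈ I) {m : Fin n →₀ ℕ}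
    (hm : m ∈ (leadingForm P).support) (p : Bipartition n)
    (φ : (leadingForm P).vars → p.fst.cells ⊕ p.snd.cells) (hφ : Function.Injective φ)
    (htop : ∀ i b, cellCol p b = cellCol p (φ i) → cellRow p b ≤ cellRow p (φ i))
    (hexp : ∀ i : (leadingForm P).vars, m i = 2 * cellRow p (φ i) + cellCol p (φ i) % 2) :
    spechtIdeal K p ≤ I := by
  classical
  have hcard : Fintype.card (Fin n) = Fintype.card (p.fst.cells ⊕ p.snd.cells) := by
    rw [Fintype.card_sum, Fintype.card_coe, Fintype.card_coe, Fintype.card_fin]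
    exact p.card_add.symm
  -- The partial placement `φ` is completed to a full bitableau; how the remaining boxes are filled
  -- is irrelevant.
  obtain ⟨e, he⟩ : ∃ e : Fin n ≃ p.fst.cells ⊕ p.snd.cells,
      ∀ i : (leadingForm P).vars, e i = φ i := by
    let e₀ := Fintype.equivOfCardEq hcard
    let g : {i // i ∈ (leadingForm P).vars} ≃ {i // i ∈ Set.range (e₀.symm ∘ φ)} :=
      Equiv.ofInjective _ (e₀.symm.injective.comp hφ)
    refine ⟨g.extendSubtype.trans e₀, fun i => ?_⟩
    rw [Equiv.trans_apply, Equiv.extendSubtype_apply_of_mem _ _ i.2]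
    simp [g]
  refine Ideal.span_le.2 ?_
  rintro _ ⟨T, rfl⟩
  obtain ⟨ε, hε⟩ := bnSpechtPoly_eq_det K p e.symm
  have hmem : bnSpechtPoly K p e.symm ∈ I := by
    rw [hε]
    refine I.mul_mem_left _ (det_colMatrix_mem hI hP hm
      ((isRowIndex_cells p).comp_equiv _) ?_ ?_)
    · intro i hi b hb
      have := htop (⟨i, hi⟩ : (leadingForm P).vars) (e b)
      rw [← he] at this
      exact this hb
    · intro i hi
      have := hexp (⟨i, hi⟩ : (leadingForm P).vars)
      rw [← he] at this
      exact this
  -- Permutations act transitively on the bitableaux of a shape, and `e.trans T` carries `e.symm` to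
  -- `T`.
  have := hI _ hmem 1 (e.trans T)
  rw [bnAct_bnSpechtPoly] at this
  rwa [← Equiv.trans_assoc, Equiv.symm_trans_self, Equiv.refl_trans] at this

end Cells

/-! ### The Specht ideal attached to a monomial of the leading form -/

section Fit

theorem exists_injective_of_card_fiber_le {β δ γ : Type*} [Fintype β] [Fintype δ] [DecidableEq γ]
    (f : β → γ) (g : δ → γ)
    (h : ∀ v, (Finset.univ.filter fun b => f b = v).card ≤
      (Finset.univ.filter fun d => g d = v).card) :
    ∃ ψ : β → δ, Function.Injective ψ ∧ ∀ b, g (ψ b) = f b := by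
  have h' : ∀ v, Nonempty ({b // f b = v} ↪ {d // g d = v}) := fun v =>
    Function.Embedding.nonempty_of_card_le (by simpa [Fintype.card_subtype] using h v)
  let E := fun v => (h' v).some
  have hE : ∀ b, g (E (f b) ⟨b, rfl⟩) = f b := fun b => (E (f b) ⟨b, rfl⟩).2
  refine ⟨fun b => E (f b) ⟨b, rfl⟩, fun a b hab => ?_, hE⟩
  have hf : f a = f b := by rw [← hE a, ← hE b]; exact congrArg g hab
  have hcast : ∀ v (ha : f a = v) (hb : f b = v),
      (E v ⟨a, ha⟩ : δ) = E v ⟨b, hb⟩ → a = b := fun v ha hb he =>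
    congrArg Subtype.val ((E v).injective (Subtype.ext he))
  refine hcast (f b) hf rfl ?_
  have hcongr : ∀ v (ha : f a = v), (E v ⟨a, ha⟩ : δ) = E (f a) ⟨a, rfl⟩ := by
    rintro _ rfl; rfl
  exact (hcongr _ hf).trans hab

theorem map_rowLen_ofParts (s : Multiset ℕ) :
    (Multiset.range s.card).map (ofParts s).rowLen = s := by
  have hlen : (s.sort fun a b => b ≤ a).length = s.card := Multiset.length_sort _
  rw [← hlen, Multiset.range, Multiset.map_coe]
  conv_rhs => rw [← s.sort_eq (fun a b => b ≤ a)]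
  congr 1
  refine List.ext_getElem (by simp) fun i h₁ h₂ => ?_
  rw [List.getElem_map, List.getElem_range]
  exact YoungDiagram.rowLen_ofRowLens ⟨i, h₂⟩

/-- Multiset inclusion counts multiplicities, so each length is available in at least as many rows
as are requested. After transposition this assigns distinct columns to distinct variables. -/
theorem exists_rows_of_map_le {β : Type*} [Fintype β] (f : β → ℕ) (s : Multiset ℕ)
    (h : (Finset.univ : Finset β).val.map f ≤ s) :
    ∃ ψ : β → ℕ, Function.Injective ψ ∧ ∀ b, (ofParts s).rowLen (ψ b) = f b := by
  obtain ⟨ψ, hψ, hf⟩ := exists_injective_of_card_fiber_le f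
    (fun j : Fin s.card => (ofParts s).rowLen j) (by
      intro v
      have h1 := Multiset.count_le_of_le v h
      have h2 : (Finset.univ : Finset (Fin s.card)).val.map
          (fun j : Fin s.card => (ofParts s).rowLen j) = s := by
        conv_rhs => rw [← map_rowLen_ofParts s]
        rw [Fin.univ_val_map, Multiset.range, Multiset.map_coe]
        congr 1
        exact List.ext_getElem (by simp) fun i h₁ h₂ => by simp
      conv_rhs at h1 => rw [← h2]
      rw [Multiset.count_map, Multiset.count_map] at h1
      simp only [eq_comm (a := v)] at h1
      exact h1)
  exact ⟨fun b => ψ b, fun a b hab => hψ (Fin.ext hab), hf⟩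

variable {K : Type*} [Field K] {n : ℕ}

/-- A variable of `V` missing from `m` requests a part `0 / 2 + 1 = 1`. There are `V.card - ℓ - s`
such variables, and `hV` says exactly that the padding parts equal to 1 suffice for them. -/
theorem map_even_le {m : Fin n →₀ ℕ} (V : Finset (Fin n)) (hmV : ∀ i, i ∉ V → m i = 0)
    (hV : V.card + d₁ m + d₂ m ≤ n) :
    (Finset.univ : Finset {i // i ∈ V ∧ Even (m i)}).val.map
      (fun i : {i // i ∈ V ∧ Even (m i)} => m i / 2 + 1) ≤
      (evenSet m).val.map (fun i => m i / 2 + 1) +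
        Multiset.replicate (n - ((evenSet m).card + (oddSet m).card + d₁ m + d₂ m)) 1 := by
  classical
  set V₀ := V.filter fun i => m i = 0 with hV₀
  have hsplit : V.filter (fun i => Even (m i)) = (evenSet m).disjUnion V₀ (by
      rw [Finset.disjoint_left]
      intro i hi hi'
      exact (Finset.mem_filter.1 hi).2.2 (Finset.mem_filter.1 hi').2) := by
    ext i
    simp only [evenSet, hV₀, Finset.mem_filter, Finset.mem_disjUnion, Finset.mem_univ, true_and]
    by_cases h0 : m i = 0
    · simp [h0]
    · have : i ∈ V := by by_contra h; exact h0 (hmV i h)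
      simp [h0, this]
  have hcard : V.card = (evenSet m).card + (oddSet m).card + V₀.card := by
    rw [← Finset.card_filter_add_card_filter_not (s := V) (fun i => Even (m i)), hsplit,
      Finset.card_disjUnion]
    have : V.filter (fun i => ¬ Even (m i)) = oddSet m := by
      ext i
      simp only [oddSet, Finset.mem_filter, Finset.mem_univ, true_and, Nat.not_even_iff_odd,
        and_iff_right_iff_imp]
      intro hi
      by_contra h
      simp [hmV i h] at hi
    rw [this]
    ring
  have hval : (Finset.univ : Finset {i // i ∈ V ∧ Even (m i)}).val.map
      (fun i : {i // i ∈ V ∧ Even (m i)} => m i / 2 + 1) =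
      (V.filter fun i => Even (m i)).val.map (fun i => m i / 2 + 1) := by
    have : V.filter (fun i => Even (m i)) =
        (Finset.univ : Finset {i // i ∈ V ∧ Even (m i)}).map (Function.Embedding.subtype _) := by
      ext i; simp
    rw [this, Finset.map_val, Multiset.map_map]
    rfl
  rw [hval, hsplit]
  change ((evenSet m).val + V₀.val).map _ ≤ _
  rw [Multiset.map_add]
  refine add_le_add le_rfl ?_
  have : V₀.val.map (fun i => m i / 2 + 1) = Multiset.replicate V₀.card 1 := by
    rw [Finset.card, ← Multiset.map_const']
    refine Multiset.map_congr rfl fun i hi => ?_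
    have : m i = 0 := (Finset.mem_filter.1 hi).2
    simp [this]
  rw [this, Multiset.replicate_le_replicate]
  omega

theorem map_odd_le {m : Fin n →₀ ℕ} (V : Finset (Fin n)) :
    (Finset.univ : Finset {i // i ∈ V ∧ ¬ Even (m i)}).val.map
      (fun i : {i // i ∈ V ∧ ¬ Even (m i)} => m i / 2 + 1) ≤
      (oddSet m).val.map (fun i => m i / 2 + 1) := by
  have : ((Finset.univ : Finset {i // i ∈ V ∧ ¬ Even (m i)}).map
      (Function.Embedding.subtype _)) ⊆ oddSet m := by
    intro i
    simp [oddSet]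
  have h := Multiset.map_le_map (f := fun i => m i / 2 + 1) (Finset.val_le_iff.2 this)
  rwa [Finset.map_val, Multiset.map_map] at h

/-- The columns of `GammaStar m` are the parts of `Gamma m`. A variable with exponent `2r` or `2r +
1` thus gets a column of height `r + 1`, whose bottom box is in row `r`, as `spechtIdeal_le_of_fit`
demands. -/
theorem spechtIdeal_GammaStar_le [CharZero K] {I : Ideal (MvPolynomial (Fin n) K)}
    (hI : IsBnInvariant I) {P : MvPolynomial (Fin n) K} (hP : P ∈ I) {m : Fin n →₀ ℕ}
    (hm : m ∈ (leadingForm P).support) (hwt : wt (leadingForm P) + d₁ m + d₂ m ≤ n) :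
    spechtIdeal K (GammaStar m (gamma_cond hm hwt)) ≤ I := by
  classical
  set V := (leadingForm P).vars with hV
  set p := GammaStar m (gamma_cond hm hwt) with hp
  have hmV : ∀ i, i ∉ V → m i = 0 := by
    intro i hi
    by_contra h0
    exact hi ((mem_vars_iff_mem_support i).2 ⟨m, hm, Finsupp.mem_support_iff.2 h0⟩)
  obtain ⟨ψ₁, hψ₁, hf₁⟩ := exists_rows_of_map_le _ _ (map_even_le V hmV hwt)
  obtain ⟨ψ₂, hψ₂, hf₂⟩ := exists_rows_of_map_le _ _ (map_odd_le (m := m) V)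
  replace hf₁ : ∀ b, p.fst.colLen (ψ₁ b) = m b / 2 + 1 := fun b =>
    (YoungDiagram.colLen_transpose _ _).trans (hf₁ b)
  replace hf₂ : ∀ b, p.snd.colLen (ψ₂ b) = m b / 2 + 1 := fun b =>
    (YoungDiagram.colLen_transpose _ _).trans (hf₂ b)
  have hc₁ : ∀ b : {i // i ∈ V ∧ Even (m i)}, (m b / 2, ψ₁ b) ∈ p.fst.cells := fun b =>
    YoungDiagram.mem_iff_lt_colLen.2 (by rw [hf₁]; exact Nat.lt_succ_self _)
  have hc₂ : ∀ b : {i // i ∈ V ∧ ¬ Even (m i)}, (m b / 2, ψ₂ b) ∈ p.snd.cells := fun b =>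
    YoungDiagram.mem_iff_lt_colLen.2 (by rw [hf₂]; exact Nat.lt_succ_self _)
  let φ : V → p.fst.cells ⊕ p.snd.cells := fun i =>
    if h : Even (m i) then Sum.inl ⟨_, hc₁ ⟨i, i.2, h⟩⟩ else Sum.inr ⟨_, hc₂ ⟨i, i.2, h⟩⟩
  have hφ₁ : ∀ (i : V) (h : Even (m i)), φ i = Sum.inl ⟨_, hc₁ ⟨i, i.2, h⟩⟩ := fun i h => dif_pos h
  have hφ₂ : ∀ (i : V) (h : ¬ Even (m i)), φ i = Sum.inr ⟨_, hc₂ ⟨i, i.2, h⟩⟩ :=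
    fun i h => dif_neg h
  refine spechtIdeal_le_of_fit hI hP hm p φ ?_ ?_ ?_
  · intro i j hij
    by_cases hi : Even (m i) <;> by_cases hj : Even (m j)
    · rw [hφ₁ i hi, hφ₁ j hj] at hij
      simp only [Sum.inl.injEq, Subtype.mk.injEq, Prod.mk.injEq] at hij
      have := congrArg Subtype.val (hψ₁ hij.2)
      exact Subtype.ext this
    · rw [hφ₁ i hi, hφ₂ j hj] at hij
      cases hij
    · rw [hφ₂ i hi, hφ₁ j hj] at hij
      cases hij
    · rw [hφ₂ i hi, hφ₂ j hj] at hij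
      simp only [Sum.inr.injEq, Subtype.mk.injEq, Prod.mk.injEq] at hij
      have := congrArg Subtype.val (hψ₂ hij.2)
      exact Subtype.ext this
  · intro i b hb
    by_cases hi : Even (m i)
    · rw [hφ₁ i hi] at hb ⊢
      rcases b with ⟨⟨r, c⟩, hrc⟩ | ⟨⟨r, c⟩, hrc⟩ <;> simp only [cellCol, cellRow, Sum.elim_inl,
        Sum.elim_inr] at hb ⊢
      · obtain rfl : c = ψ₁ ⟨i, i.2, hi⟩ := by omega
        have : r < _ := YoungDiagram.mem_iff_lt_colLen.1 hrc
        rw [hf₁] at this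
        exact Nat.lt_succ_iff.1 this
      · omega
    · rw [hφ₂ i hi] at hb ⊢
      rcases b with ⟨⟨r, c⟩, hrc⟩ | ⟨⟨r, c⟩, hrc⟩ <;> simp only [cellCol, cellRow, Sum.elim_inl,
        Sum.elim_inr] at hb ⊢
      · omega
      · obtain rfl : c = ψ₂ ⟨i, i.2, hi⟩ := by omega
        have : r < _ := YoungDiagram.mem_iff_lt_colLen.1 hrc
        rw [hf₂] at this
        exact Nat.lt_succ_iff.1 this
  · intro i
    by_cases hi : Even (m i)
    · rw [hφ₁ i hi]
      simp only [cellCol, cellRow, Sum.elim_inl]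
      rw [Nat.even_iff] at hi
      omega
    · rw [hφ₂ i hi]
      simp only [cellCol, cellRow, Sum.elim_inr]
      rw [Nat.even_iff] at hi
      omega

end Fit
/-! ### A Gale–Ryser construction -/

section GaleRyser

variable {ι γ : Type*} [DecidableEq ι] [DecidableEq γ]

theorem exists_largest_subset (T : Finset ι) (h : ι → ℕ) {t : ℕ} (ht : t ≤ T.card) :
    ∃ R ⊆ T, R.card = t ∧ ∀ a ∈ R, ∀ b ∈ T, b ∉ R → h b ≤ h a := by
  induction t with
  | zero => exact ⟨∅, by simp⟩
  | succ t ih =>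
    obtain ⟨R, hRT, hR, hmax⟩ := ih (by omega)
    have hne : (T \ R).Nonempty := by
      rw [← Finset.card_pos, Finset.card_sdiff_of_subset hRT]
      omega
    obtain ⟨a, ha, hamax⟩ := Finset.exists_max_image _ h hne
    rw [Finset.mem_sdiff] at ha
    refine ⟨insert a R, Finset.insert_subset ha.1 hRT, by
      rw [Finset.card_insert_of_notMem ha.2, hR], ?_⟩
    intro b hb c hc hcR
    rw [Finset.mem_insert, not_or] at hcR
    rcases Finset.mem_insert.1 hb with rfl | hb
    · exact hamax c (Finset.mem_sdiff.2 ⟨hc, hcR.2⟩)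
    · exact hmax b hb c hc hcR.2

/-- One step of the greedy algorithm: choose `t` columns among the allowed ones `T`, as tall as
possible, and shorten them by one. -/
theorem exists_shortening (C T : Finset ι) (hTC : T ⊆ C) (h : ι → ℕ) {t : ℕ}
    (ht : t ≤ ∑ c ∈ T, min (h c) 1) :
    ∃ R ⊆ T, R.card = t ∧ (∀ c ∈ R, 1 ≤ h c) ∧ ∀ k w, w ≤ ∑ c ∈ C, min (h c) k →
      w + t ≤ ∑ c ∈ C \ T, min (h c) k + ∑ c ∈ T, min (h c) (k + 1) →
        w ≤ ∑ c ∈ C, min (h c - if c ∈ R then 1 else 0) k := by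
  have ht' : t ≤ (T.filter fun c => 1 ≤ h c).card := by
    rw [Finset.card_filter]
    refine ht.trans (Finset.sum_le_sum fun c _ => ?_)
    split_ifs <;> omega
  obtain ⟨R, hRT, hR, hmax⟩ := exists_largest_subset T h
    (ht'.trans (Finset.card_le_card (Finset.filter_subset _ _)))
  have hpos : ∀ c ∈ R, 1 ≤ h c := by
    intro a ha
    by_contra h0
    have hsub : (T.filter fun c => 1 ≤ h c) ⊆ R.erase a := by
      intro b hb
      rw [Finset.mem_filter] at hb
      have hbR : b ∈ R := by
        by_contra hbR
        have := hmax a ha b hb.1 hbR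
        omega
      exact Finset.mem_erase.2 ⟨fun hba => h0 (hba ▸ hb.2), hbR⟩
    have := Finset.card_le_card hsub
    rw [Finset.card_erase_of_mem ha] at this
    have := Finset.card_pos.2 ⟨a, ha⟩
    omega
  refine ⟨R, hRT, hR, hpos, fun k w h1 h2 => ?_⟩
  -- If a chosen column has height at most `k`, then by maximality so has every unchosen column of
  -- `T`; passing from `k + 1` to `k` then costs exactly one per chosen column, and the second
  -- inequality applies. Otherwise all chosen columns exceed `k`, shortening does not affect
  -- truncation at `k`, and the first inequality suffices.
  by_cases hk : ∃ a ∈ R, h a ≤ k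
  · obtain ⟨a, ha, hak⟩ := hk
    have hT : ∑ c ∈ T, min (h c) (k + 1) =
        ∑ c ∈ T, min (h c - if c ∈ R then 1 else 0) k + t := by
      rw [← hR, ← Finset.filter_mem_eq_inter.trans (Finset.inter_eq_right.2 hRT),
        Finset.card_filter, ← Finset.sum_add_distrib]
      refine Finset.sum_congr rfl fun c hc => ?_
      simp only [Finset.mem_filter, hc, true_and]
      split_ifs with hcR
      · have := hpos c hcR
        omega
      · have := hmax a ha c hc hcR
        omega
    have hCT : ∑ c ∈ C \ T, min (h c) k =
        ∑ c ∈ C \ T, min (h c - if c ∈ R then 1 else 0) k := by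
      refine Finset.sum_congr rfl fun c hc => ?_
      rw [if_neg fun hcR => (Finset.mem_sdiff.1 hc).2 (hRT hcR), Nat.sub_zero]
    rw [← Finset.sum_sdiff hTC]
    omega
  · push Not at hk
    refine h1.trans (Finset.sum_le_sum fun c _ => ?_)
    split_ifs with hcR
    · have := hk c hcR
      omega
    · simp

theorem sum_sub_indicator_add_card {C R : Finset ι} (hRC : R ⊆ C) {h : ι → ℕ}
    (hpos : ∀ c ∈ R, 1 ≤ h c) :
    ∑ c ∈ C, (h c - if c ∈ R then 1 else 0) + R.card = ∑ c ∈ C, h c := by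
  rw [← Finset.inter_eq_right.2 hRC, ← Finset.filter_mem_eq_inter, Finset.card_filter,
    ← Finset.sum_add_distrib]
  refine Finset.sum_congr rfl fun c hc => ?_
  simp only [Finset.mem_filter, hc, true_and]
  split_ifs with hcR
  · exact Nat.sub_add_cancel (hpos c hcR)
  · simp

theorem incidence_insert {F : Finset γ} {v : γ} (hv : v ∉ F) {size : γ → ℕ} {C R₀ : Finset ι}
    {h : ι → ℕ} (hR₀C : R₀ ⊆ C) (hR₀ : R₀.card = size v) (hpos : ∀ c ∈ R₀, 1 ≤ h c)
    {R : γ → Finset ι} (hR : ∀ u ∈ F, R u ⊆ C ∧ (R u).card = size u)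
    (hRc : ∀ c ∈ C, (F.filter fun u => c ∈ R u).card = h c - if c ∈ R₀ then 1 else 0) :
    (∀ u ∈ insert v F, Function.update R v R₀ u ⊆ C ∧
        (Function.update R v R₀ u).card = size u) ∧
      ∀ c ∈ C, ((insert v F).filter fun u => c ∈ Function.update R v R₀ u).card = h c := by
  have hne : ∀ u ∈ F, u ≠ v := fun u hu huv => hv (huv ▸ hu)
  refine ⟨?_, ?_⟩
  · intro u hu
    rcases Finset.mem_insert.1 hu with rfl | hu
    · rw [Function.update_self]
      exact ⟨hR₀C, hR₀⟩
    · rw [Function.update_of_ne (hne u hu)]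
      exact hR u hu
  · intro c hc
    have hF : (F.filter fun u => c ∈ Function.update R v R₀ u) = F.filter fun u => c ∈ R u :=
      Finset.filter_congr fun u hu => by rw [Function.update_of_ne (hne u hu)]
    rw [Finset.filter_insert, hF, Function.update_self]
    have h1 := hRc c hc
    split_ifs at h1 ⊢ with hcR
    · rw [Finset.card_insert_of_notMem (by simp [hv]), h1]
      exact Nat.sub_add_cancel (hpos c hcR)
    · simpa using h1

/-- The Gale–Ryser theorem, with the dominance condition stated for all sets of rows. -/
theorem exists_incidence (F : Finset γ) (size : γ → ℕ) (C : Finset ι) (h : ι → ℕ)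
    (hle : ∀ A ⊆ F, ∑ v ∈ A, size v ≤ ∑ c ∈ C, min (h c) A.card)
    (heq : ∑ v ∈ F, size v = ∑ c ∈ C, h c) :
    ∃ R : γ → Finset ι, (∀ v ∈ F, R v ⊆ C ∧ (R v).card = size v) ∧
      ∀ c ∈ C, (F.filter fun v => c ∈ R v).card = h c := by
  induction F using Finset.induction_on generalizing h with
  | empty =>
    refine ⟨fun _ => ∅, by simp, fun c hc => ?_⟩
    rw [Finset.sum_empty] at heq
    simpa using (Finset.sum_eq_zero_iff.1 heq.symm c hc).symm
  | insert v F hv ih =>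
    obtain ⟨R₀, hR₀C, hR₀, hpos, hstep⟩ := exists_shortening C C subset_rfl h (t := size v)
      (by simpa using hle {v} (by simp))
    obtain ⟨R, hR, hRc⟩ := ih (fun c => h c - if c ∈ R₀ then 1 else 0) (by
        intro A hA
        have hvA : v ∉ A := fun h => hv (hA h)
        have := hle (insert v A) (Finset.insert_subset_insert v hA)
        rw [Finset.sum_insert hvA, Finset.card_insert_of_notMem hvA] at this
        exact hstep _ _ (hle A (hA.trans (Finset.subset_insert v F)))
          (by rw [Finset.sdiff_self, Finset.sum_empty]; omega)) (by
        have := sum_sub_indicator_add_card hR₀C hpos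
        rw [Finset.sum_insert hv] at heq
        omega)
    exact ⟨Function.update R v R₀, incidence_insert hv hR₀C hR₀ hpos hR hRc⟩

/-- A Gale–Ryser theorem in which one row `v₀` may only meet the columns in `T`. -/
theorem exists_incidence_restricted (F : Finset γ) {v₀ : γ} (hv₀ : v₀ ∉ F) (size : γ → ℕ)
    (C T : Finset ι) (hTC : T ⊆ C) (h : ι → ℕ)
    (hle : ∀ A ⊆ F, ∑ v ∈ A, size v ≤ ∑ c ∈ C, min (h c) A.card)
    (hle₀ : ∀ A ⊆ F, ∑ v ∈ A, size v + size v₀ ≤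
      ∑ c ∈ C \ T, min (h c) A.card + ∑ c ∈ T, min (h c) (A.card + 1))
    (heq : ∑ v ∈ F, size v + size v₀ = ∑ c ∈ C, h c) :
    ∃ R : γ → Finset ι, (∀ v ∈ insert v₀ F, R v ⊆ C ∧ (R v).card = size v) ∧ R v₀ ⊆ T ∧
      ∀ c ∈ C, ((insert v₀ F).filter fun v => c ∈ R v).card = h c := by
  -- The greedy algorithm may treat the rows in any order, so the restricted row goes first; what is
  -- left is an unrestricted problem.
  obtain ⟨R₀, hR₀T, hR₀, hpos, hstep⟩ := exists_shortening C T hTC h (t := size v₀)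
    (by simpa using hle₀ ∅ (by simp))
  obtain ⟨R, hR, hRc⟩ := exists_incidence F size C (fun c => h c - if c ∈ R₀ then 1 else 0)
    (fun A hA => hstep _ _ (hle A hA) (hle₀ A hA)) (by
      have := sum_sub_indicator_add_card (hR₀T.trans hTC) hpos
      omega)
  obtain ⟨h1, h2⟩ := incidence_insert hv₀ (hR₀T.trans hTC) hR₀ hpos hR hRc
  exact ⟨Function.update R v₀ R₀, h1, by rwa [Function.update_self], h2⟩

end GaleRyser
/-! ### Row sums -/

section RowSums

theorem sum_le_sum_range_of_antitone {r : ℕ → ℕ} (hr : Antitone r) (s : Finset ℕ) :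
    ∑ j ∈ s, r j ≤ ∑ j ∈ Finset.range s.card, r j := by
  induction s using Finset.induction_on_max with
  | empty => simp
  | insert a s ha ih =>
    have hmem : a ∉ s := fun h => (ha a h).false
    have hcard : s.card ≤ a := by
      simpa using Finset.card_le_card (fun x hx => Finset.mem_range.2 (ha x hx) :
        s ⊆ Finset.range a)
    rw [Finset.card_insert_of_notMem hmem, Finset.sum_range_succ, Finset.sum_insert hmem]
    have := hr hcard
    omega

theorem sum_le_sum_rowLen_ofParts {β : Type*} {B A : Finset β} (hAB : A ⊆ B) (f : β → ℕ) :
    ∑ b ∈ A, f b ≤ ∑ j ∈ Finset.range A.card, (ofParts (B.val.map f)).rowLen j := by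
  classical
  obtain ⟨ψ, hψ, hf⟩ := exists_rows_of_map_le (fun b : A => f b) (B.val.map f) (by
    have h1 : A.val.map f ≤ B.val.map f := Multiset.map_le_map (Finset.val_le_iff.2 hAB)
    rwa [← Finset.attach_map_val (s := A), Finset.map_val, Multiset.map_map] at h1)
  have hcard : (Finset.univ.image ψ).card = A.card := by
    rw [Finset.card_image_of_injective _ hψ, Finset.card_univ, Fintype.card_coe]
  rw [← Finset.sum_coe_sort A f, ← Finset.sum_congr rfl fun b _ => hf b,
    ← Finset.sum_image (f := (ofParts (B.val.map f)).rowLen) hψ.injOn, ← hcard]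
  exact sum_le_sum_range_of_antitone (fun i j => YoungDiagram.rowLen_anti _ i j) _

/-- Monotonicity keeps the mapped parts sorted, and `g 0 = 0` makes the formula valid beyond the
last row. -/
theorem rowLen_ofParts_map (ν : YoungDiagram) {g : ℕ → ℕ} (hg : Monotone g) (h0 : g 0 = 0)
    (j : ℕ) : (ofParts ((ν.rowLens : Multiset ℕ).map g)).rowLen j = g (ν.rowLen j) := by
  have hsorted : (ν.rowLens.map g).SortedGE :=
    ((List.pairwise_map.2 (ν.rowLens_sorted.pairwise.imp fun h => hg h))).sortedGE
  have hof : ofParts ((ν.rowLens : Multiset ℕ).map g) =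
      YoungDiagram.ofRowLens (ν.rowLens.map g) hsorted := by
    rw [ofParts]
    congr 1
    refine List.Perm.eq_of_pairwise (le := fun a b => b ≤ a) (fun a b _ _ h h' => le_antisymm h' h)
      (Multiset.pairwise_sort _ _) hsorted.pairwise ?_
    rw [← Multiset.coe_eq_coe, Multiset.sort_eq, Multiset.map_coe]
  rw [hof]
  refine eq_of_forall_lt_iff fun x => ?_
  rw [← YoungDiagram.mem_iff_lt_rowLen, YoungDiagram.mem_ofRowLens]
  simp only [List.length_map, YoungDiagram.length_rowLens, List.getElem_map,
    YoungDiagram.get_rowLens, exists_prop, and_iff_right_iff_imp]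
  intro hx
  rw [← YoungDiagram.mem_iff_lt_colLen, YoungDiagram.mem_iff_lt_rowLen]
  by_contra h
  rw [Nat.eq_zero_of_not_pos h, h0] at hx
  exact Nat.not_lt_zero _ hx

theorem sum_rowLen_eq_card (ν : YoungDiagram) (k : ℕ) :
    ∑ j ∈ Finset.range k, ν.rowLen j =
      (Finset.univ.filter fun c : ν.cells => c.1.1 < k).card := by
  rw [← Finset.card_map (Function.Embedding.subtype _),
    Finset.card_eq_sum_card_fiberwise (f := Prod.fst) (t := Finset.range k)
      (by intro c; simp; intros; omega)]
  refine Finset.sum_congr rfl fun j hj => ?_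
  rw [YoungDiagram.rowLen_eq_card]
  congr 1
  ext c
  rw [Finset.mem_range] at hj
  simp [YoungDiagram.mem_row_iff]
  aesop

/-- Double counting: a column meets the first `k` rows in as many boxes as the minimum of its height
and `k`. -/
theorem IsRowIndex.sum_min_eq_card {α : Type*} [Fintype α] {col row : α → ℕ}
    (h : IsRowIndex col row) (Q : ℕ → Prop) [DecidablePred Q] (k : ℕ) :
    ∑ c ∈ (Finset.univ.image col).filter Q, min (Finset.univ.filter fun a => col a = c).card k =
      (Finset.univ.filter fun a => Q (col a) ∧ row a < k).card := by
  rw [Finset.card_eq_sum_card_fiberwise (f := col) (t := (Finset.univ.image col).filter Q)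
      (by intro a; simp; intros; assumption)]
  refine Finset.sum_congr rfl fun c hc => ?_
  obtain ⟨l, e, he⟩ := h.exists_equiv c
  have h1 : (Finset.univ.filter fun a => col a = c).card = l := by
    rw [← Fintype.card_subtype, Fintype.card_congr e, Fintype.card_fin]
  have h2 : ((Finset.univ.filter fun a => Q (col a) ∧ row a < k).filter fun a => col a = c) =
      (Finset.univ.filter fun i : Fin l => (i : ℕ) < k).map
        (e.symm.toEmbedding.trans (Function.Embedding.subtype _)) := by
    ext a
    simp only [Finset.mem_filter, Finset.mem_univ, true_and, Finset.mem_map,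
      Function.Embedding.trans_apply, Equiv.coe_toEmbedding, Function.Embedding.subtype_apply]
    constructor
    · rintro ⟨⟨-, h2⟩, h3⟩
      exact ⟨e ⟨a, h3⟩, by rwa [he], by simp⟩
    · rintro ⟨i, hi, rfl⟩
      refine ⟨⟨?_, ?_⟩, (e.symm i).2⟩
      · rw [(e.symm i).2]
        exact (Finset.mem_filter.1 hc).2
      · rwa [← he, Equiv.apply_symm_apply]
  rw [h2, Finset.card_map, h1, Fin.card_filter_val_lt]

end RowSums

/-! ### Truncated column heights and partial row sums of a bipartition -/

section Cells

variable {n : ℕ} (p : Bipartition n)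

/-- The numbers of the columns of a bipartition. -/
def columns : Finset ℕ := Finset.univ.image (cellCol p)

/-- The height of a column of a bipartition. -/
def colHeight (c : ℕ) : ℕ := (Finset.univ.filter fun a => cellCol p a = c).card

theorem sum_min_even (k : ℕ) :
    ∑ c ∈ (columns p).filter Even, min (colHeight p c) k =
      ∑ j ∈ Finset.range k, p.fst.rowLen j := by
  simp only [colHeight, columns]
  rw [(isRowIndex_cells p).sum_min_eq_card, sum_rowLen_eq_card,
    ← Finset.card_map (Function.Embedding.inl : p.fst.cells ↪ p.fst.cells ⊕ p.snd.cells)]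
  congr 1
  ext a
  rcases a with a | a <;> rw [Finset.mem_filter] <;> simp [cellCol, cellRow]

theorem sum_min_odd (k : ℕ) :
    ∑ c ∈ columns p \ (columns p).filter Even, min (colHeight p c) k =
      ∑ j ∈ Finset.range k, p.snd.rowLen j := by
  rw [← Finset.filter_not]
  simp only [colHeight, columns]
  rw [(isRowIndex_cells p).sum_min_eq_card, sum_rowLen_eq_card,
    ← Finset.card_map (Function.Embedding.inr : p.snd.cells ↪ p.fst.cells ⊕ p.snd.cells)]
  congr 1
  ext a
  rcases a with a | a <;> rw [Finset.mem_filter] <;> simp [cellCol, cellRow]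

theorem sum_min_columns (k : ℕ) :
    ∑ c ∈ columns p, min (colHeight p c) k =
      ∑ j ∈ Finset.range k, (p.fst.rowLen j + p.snd.rowLen j) := by
  rw [← Finset.sum_sdiff (Finset.filter_subset Even (columns p)), sum_min_even, sum_min_odd,
    Finset.sum_add_distrib, add_comm]

theorem sum_colHeight : ∑ c ∈ columns p, colHeight p c = n := by
  have h := Finset.card_eq_sum_card_image (cellCol p) Finset.univ
  rw [Finset.card_univ, Fintype.card_sum, Fintype.card_coe, Fintype.card_coe] at h
  exact h.symm.trans p.card_add

end Cells

/-! ### Nonvanishing Specht polynomials at points of bidominated orbit type -/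

section Nonvanishing

variable {K : Type*} [Field K] {n : ℕ}

open Classical in
-- This translates bidominance into the two families of Gale–Ryser inequalities. The parts of the
-- two diagrams of the orbit type add up rowwise to `Λ`, whose partial sums bound the total
-- multiplicity of any set of values.
theorem bidominates_bnOrbitType {p : Bipartition n} {z : Fin n → K}
    (h : Bidominates p (bnOrbitType z)) (A : Finset K)
    (hA : A ⊆ (Finset.univ.image fun i => z i ^ 2).erase 0) :
    (∑ v ∈ A, (Finset.univ.filter fun i => z i ^ 2 = v).card ≤
      ∑ j ∈ Finset.range A.card, (p.fst.rowLen j + p.snd.rowLen j)) ∧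
    (∑ v ∈ A, (Finset.univ.filter fun i => z i ^ 2 = v).card +
        (Finset.univ.filter fun i => z i ^ 2 = 0).card ≤
      ∑ j ∈ Finset.range A.card, (p.fst.rowLen j + p.snd.rowLen j) + p.fst.rowLen A.card) := by
  set Λ := snOrbitType fun i => z i ^ 2 with hΛ
  set t := numZeros z with ht
  have hsize : (Finset.univ.filter fun i => z i ^ 2 = 0).card = t := by
    rw [ht, numZeros]
    congr 1
    ext i
    simp
  have hfst : ∀ j, (bnOrbitType z).fst.rowLen j = min (Λ.rowLen j) t := fun j =>
    rowLen_ofParts_map Λ (g := fun a => min a t) (fun a b hab => min_le_min_right t hab)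
      (Nat.zero_min t) j
  have hsnd : ∀ j, (bnOrbitType z).snd.rowLen j = Λ.rowLen j - t := fun j =>
    rowLen_ofParts_map Λ (g := fun a => a - t) (fun a b hab => Nat.sub_le_sub_right hab t)
      (Nat.zero_sub t) j
  have hadd : ∀ j, (bnOrbitType z).fst.rowLen j + (bnOrbitType z).snd.rowLen j = Λ.rowLen j :=
    fun j => by rw [hfst, hsnd]; omega
  have htop : ∀ B ⊆ Finset.univ.image (fun i => z i ^ 2),
      ∑ v ∈ B, (Finset.univ.filter fun i => z i ^ 2 = v).card ≤
        ∑ j ∈ Finset.range B.card, Λ.rowLen j := fun B hB =>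
    sum_le_sum_rowLen_ofParts hB fun v => (Finset.univ.filter fun i => z i ^ 2 = v).card
  simp only [Bidominates, hadd] at h
  simp only [hfst] at h
  have hA' := htop A (hA.trans (Finset.erase_subset _ _))
  rw [hsize]
  refine ⟨?_, ?_⟩
  -- Bidominance compares sums of at least one row, so the empty set is separate.
  · rcases hk : A.card with _ | k
    · rw [Finset.card_eq_zero] at hk
      simp [hk]
    · rw [hk] at hA'
      exact hA'.trans (h k).1
  · refine le_trans ?_ (h A.card).2
    -- The next part of the first diagram is the minimum of `t` and this row of `Λ`. If it is `t`,
    -- the bound for `A` suffices. Otherwise `t > 0`, so 0 is a genuine value and `insert 0 A` is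
    -- bounded by one more row of `Λ`.
    rcases le_or_gt t (Λ.rowLen A.card) with hle | hlt
    · rw [min_eq_right hle]
      omega
    · have h0 : (0 : K) ∉ A := fun h0 => Finset.notMem_erase _ _ (hA h0)
      have hpos : 0 < (Finset.univ.filter fun i => z i ^ 2 = 0).card := by omega
      obtain ⟨i, hi⟩ := Finset.card_pos.1 hpos
      have hmem : (0 : K) ∈ Finset.univ.image fun i => z i ^ 2 :=
        Finset.mem_image.2 ⟨i, Finset.mem_univ i, (Finset.mem_filter.1 hi).2⟩
      have := htop (insert 0 A) (Finset.insert_subset hmem (hA.trans (Finset.erase_subset _ _)))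
      rw [Finset.sum_insert h0, Finset.card_insert_of_notMem h0, Finset.sum_range_succ,
        hsize] at this
      rw [min_eq_left hlt.le]
      omega

theorem aeval_bnSpechtPoly_ne_zero {p : Bipartition n} {T : Bitableau p} {z : Fin n → K}
    (h0 : ∀ a, Odd (cellCol p a) → z (T a) ≠ 0)
    (h : ∀ a b, cellCol p a = cellCol p b → z (T a) ^ 2 = z (T b) ^ 2 → a = b) :
    aeval z (bnSpechtPoly K p T) ≠ 0 := by
  rw [bnSpechtPoly_eq, map_mul, map_prod, map_prod]
  refine mul_ne_zero (Finset.prod_ne_zero_iff.2 fun a _ => ?_)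
    (Finset.prod_ne_zero_iff.2 fun a _ => ?_)
  · rw [map_pow, aeval_X]
    rcases Nat.even_or_odd (cellCol p a) with ha | ha
    · rw [Nat.even_iff.1 ha, pow_zero]
      exact one_ne_zero
    · exact pow_ne_zero _ (h0 a ha)
  · rw [map_prod, Finset.prod_ne_zero_iff]
    intro b _
    split_ifs with hab
    · rw [map_sub, map_pow, map_pow, aeval_X, aeval_X, sub_ne_zero]
      intro he
      rw [h a b hab.1 he] at hab
      exact hab.2.false
    · rw [map_one]
      exact one_ne_zero

/-- The incidence relation tells which squared values enter which column, each at most once and 0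
only in even columns. The value 0 is always the restricted row, with size 0 if no coordinate
vanishes. -/
theorem exists_aeval_bnSpechtPoly_ne_zero {p : Bipartition n} {z : Fin n → K}
    (h : Bidominates p (bnOrbitType z)) : ∃ T : Bitableau p, aeval z (bnSpechtPoly K p T) ≠ 0 := by
  classical
  set y : Fin n → K := fun i => z i ^ 2 with hy
  set size : K → ℕ := fun v => (Finset.univ.filter fun i => y i = v).card with hsize
  set F := (Finset.univ.image y).erase 0 with hF
  have h0F : (0 : K) ∉ F := Finset.notMem_erase _ _
  have hyF : ∀ i, y i ∈ insert 0 F := by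
    intro i
    by_cases hi : y i = 0
    · rw [hi]; exact Finset.mem_insert_self _ _
    · exact Finset.mem_insert_of_mem
        (Finset.mem_erase.2 ⟨hi, Finset.mem_image_of_mem y (Finset.mem_univ i)⟩)
  have hbi := bidominates_bnOrbitType h
  obtain ⟨R, hR, hR₀, hRc⟩ := exists_incidence_restricted F h0F size (columns p)
    ((columns p).filter Even) (Finset.filter_subset _ _) (colHeight p)
    (by
      intro A hA
      rw [sum_min_columns]
      convert (hbi A (by convert hA)).1 using 1)
    (by
      intro A hA
      rw [sum_min_odd, sum_min_even, Finset.sum_range_succ, ← add_assoc, ← Finset.sum_add_distrib]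
      have := (hbi A (by convert hA)).2
      simp only [add_comm (p.snd.rowLen _)]
      convert this using 1)
    (by
      rw [sum_colHeight, add_comm, ← Finset.sum_insert h0F]
      have := Finset.card_eq_sum_card_fiberwise (f := y) (s := Finset.univ) (t := insert 0 F)
        (fun i _ => hyF i)
      rw [Finset.card_univ, Fintype.card_fin] at this
      exact this.symm)
  -- Incidences mediate between boxes and coordinates: `ψ` sends a box to an incidence of its
  -- column, `χ` sends an incidence to a coordinate with its value. Equal cardinalities make the
  -- injective composite a bitableau.
  let δ := {x : K × ℕ // x ∈ (insert 0 F ×ˢ columns p).filter fun x => x.2 ∈ R x.1}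
  have : Fintype δ := Finset.Subtype.fintype _
  have hδ : ∀ x : δ, x.1.1 ∈ insert 0 F ∧ x.1.2 ∈ columns p ∧ x.1.2 ∈ R x.1.1 := by
    intro x
    have := Finset.mem_filter.1 x.2
    exact ⟨(Finset.mem_product.1 this.1).1, (Finset.mem_product.1 this.1).2, this.2⟩
  obtain ⟨ψ, hψ, hψc⟩ := exists_injective_of_card_fiber_le (cellCol p) (fun x : δ => x.1.2) (by
    intro c
    by_cases hc : c ∈ columns p
    · have h1 : (Finset.univ.filter fun a => cellCol p a = c).card = _ := (hRc c hc).symm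
      rw [h1]
      refine Finset.card_le_card_of_surjOn (fun x : δ => x.1.1) fun v hv => ?_
      have hv' := Finset.mem_filter.1 (Finset.mem_coe.1 hv)
      exact ⟨⟨(v, c), Finset.mem_filter.2 ⟨Finset.mem_product.2 ⟨hv'.1, hc⟩, hv'.2⟩⟩, by simp, rfl⟩
    · rw [Finset.card_eq_zero.2]
      · exact Nat.zero_le _
      · refine Finset.filter_eq_empty_iff.2 fun a _ ha => hc ?_
        exact Finset.mem_image.2 ⟨a, Finset.mem_univ a, ha⟩)
  obtain ⟨χ, hχ, hχy⟩ := exists_injective_of_card_fiber_le (fun x : δ => x.1.1) y (by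
    intro v
    by_cases hv : v ∈ insert 0 F
    · refine le_of_le_of_eq ?_ (hR v hv).2
      refine Finset.card_le_card_of_injOn (fun x : δ => x.1.2) (fun x hx => ?_)
        fun x hx x' hx' hxx' => ?_
      · have h1 := (hδ x).2.2
        rwa [(Finset.mem_filter.1 (Finset.mem_coe.1 hx)).2] at h1
      · exact Subtype.ext (Prod.ext ((Finset.mem_filter.1 (Finset.mem_coe.1 hx)).2.trans
          (Finset.mem_filter.1 (Finset.mem_coe.1 hx')).2.symm) hxx')
    · rw [Finset.card_eq_zero.2]
      · exact Nat.zero_le _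
      · exact Finset.filter_eq_empty_iff.2 fun x _ hx => hv (hx ▸ (hδ x).1))
  have hinj : Function.Injective (χ ∘ ψ) := hχ.comp hψ
  have hcard : Fintype.card (p.fst.cells ⊕ p.snd.cells) = Fintype.card (Fin n) := by
    rw [Fintype.card_sum, Fintype.card_coe, Fintype.card_coe, Fintype.card_fin]
    exact p.card_add
  have hbij : Function.Bijective (χ ∘ ψ) :=
    (Fintype.bijective_iff_injective_and_card _).2 ⟨hinj, hcard⟩
  refine ⟨Equiv.ofBijective _ hbij, aeval_bnSpechtPoly_ne_zero ?_ ?_⟩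
  · intro a ha hz
    have h1 : (ψ a).1.1 = 0 := by
      rw [← hχy]
      change z (χ (ψ a)) ^ 2 = 0
      rw [show z (χ (ψ a)) = 0 from hz, zero_pow two_ne_zero]
    have h2 := (hδ (ψ a)).2.2
    rw [h1] at h2
    have h3 := (Finset.mem_filter.1 (hR₀ h2)).2
    rw [hψc] at h3
    exact (Nat.not_even_iff_odd.2 ha) h3
  · intro a b hc he
    refine hψ (Subtype.ext (Prod.ext ?_ ?_))
    · rw [← hχy, ← hχy]
      exact he
    · rw [hψc, hψc, hc]

end Nonvanishing

end BnSpecht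

theorem mainTheorem5 {K : Type*} [Field K] [CharZero K] {n : ℕ}
    (I : Ideal (MvPolynomial (Fin n) K)) (hI : BnSpecht.IsBnInvariant I)
    (P : MvPolynomial (Fin n) K) (hP : P ∈ I)
    (m : Fin n →₀ ℕ) (hm : m ∈ (BnSpecht.leadingForm P).support)
    (hwt : BnSpecht.wt (BnSpecht.leadingForm P) + BnSpecht.d₁ m + BnSpecht.d₂ m ≤ n) :
    MvPolynomial.zeroLocus K I ⊆
        MvPolynomial.zeroLocus K
          (BnSpecht.spechtIdeal K (BnSpecht.GammaStar m (BnSpecht.gamma_cond hm hwt))) ∧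
      ∀ q : BnSpecht.Bipartition n,
        BnSpecht.Bidominates (BnSpecht.GammaStar m (BnSpecht.gamma_cond hm hwt)) q →
          MvPolynomial.zeroLocus K I ∩ BnSpecht.orbitSet K q = ∅ := by
  have hle := BnSpecht.spechtIdeal_GammaStar_le hI hP hm hwt
  refine ⟨MvPolynomial.zeroLocus_anti_mono hle, fun q hq => ?_⟩
  rw [Set.eq_empty_iff_forall_notMem]
  rintro z ⟨hz, rfl⟩
  obtain ⟨T, hT⟩ := BnSpecht.exists_aeval_bnSpechtPoly_ne_zero hq
  exact hT (hz _ (hle (Ideal.subset_span ⟨T, rfl⟩)))
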